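/- **Proposition 4.1 (a loop space is a homotopy monoid).** Let $\Delta$ be the category of finite ordinals $0,1,2,\dots$ and order-preserving maps, monoidal under ordinal sum $+$ with unit $0$. Let $\mathcal M$ be a monoidal category with a class of morphisms called equivalences. A *homotopy monoid* in $\mathcal M$ is a colax monoidal functor $(X,\xi):\Delta\to\mathcal M$ such that $\xi_0:X(0)\to I$ and all $\xi_{mn}:X(m+n)\to X(m)\otimes X(n)$ are equivalences. In $(\mathrm{Top},\times)$ the equivalences are the homotopy equivalences. In $(\mathrm{Top}_*^{\mathrm{op}},\vee)$ they are the pointed homotopy equivalences. Write $\mathrm{Top}_*(Y,B)$ for the space of pointed maps with the compact-open topology, and $\Omega B=\mathrm{Top}_*(S^1,B)$. Let $W(n)$ be the standard simplex $\Delta^n$ with its $n+1$ vertices collapsed to one point, the basepoint. An order-preserving map $f:m\to n$ induces $W(n)\to W(m)$, the affine map given on vertices by $\{0,\dots,n\}\to\{0,\dots,m\}$, $j\mapsto\#\{i: f(i)<j\}$. (Here $m=\{0,\dots,m-1\}$.) This defines a functor $W:\Delta\to\mathrm{Top}_*^{\mathrm{op}}$. The front face ($i\mapsto i$ on vertices)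 and the back face ($i\mapsto m+i$) define $\omega_{mn}:W(m)\vee W(n)\to W(m+n)$. Then: 1. (*$S^1$ is a homotopy comonoid.*) The map $t\mapsto e^{2\pi i t_1}$ induces a pointed homeomorphism $c:W(1)\cong S^1$. There is a colax monoidal structure on $W$ with components $\omega_{mn}$, and it makes $W$ a homotopy monoid in $(\mathrm{Top}_*^{\mathrm{op}},\vee)$. In particular every $\omega_{mn}$ is a pointed homotopy equivalence. 2. (*$\Omega B$ is canonically a homotopy monoid.*) For every pointed space $B$, the functor $X_B=\mathrm{Top}_*(W(-),B):\Delta\to\mathrm{Top}$ has a colax monoidal structure $\xi$ that makes it a homotopy monoid in $(\mathrm{Top},\times)$. The two components of $\xi_{mn}:X_B(m+n)\to X_B(m)\times X_B(n)$ are restriction along the front face $W(m)\to W(m+n)$ and along the back face $W(n)\to W(m+n)$. Moreover $X_B(1)\cong\Omega B$ by the homeomorphism induced by $c$. The maps $\xi_{mn}$ are natural in the pointed space $B$. -/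

import Mathlib

open CategoryTheory MonoidalCategory Opposite

universe u v w

noncomputable section

/-! ### Homotopy monoids -/

/-- Let `M` be a monoidal category equipped with a class `E` of morphisms, called equivalences.
A homotopy monoid in `M` is a colax monoidal functor `(X, ξ)` from the category of finite ordinals
(with ordinal sum as tensor product and the empty ordinal as unit) to `M`, such that
`ξ₀ : X(0) ⟶ I` and all `ξ_{mn} : X(m + n) ⟶ X(m) ⊗ X(n)` are equivalences.
The colax structure `ξ` is Mathlib's `Functor.OplaxMonoidal`, with `η = ξ₀` and `δ = ξ`. -/
structure IsHomotopyMonoid {M : Type u} [Category.{v} M] [MonoidalCategory M]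
    (E : MorphismProperty M) (X : AugmentedSimplexCategory ⥤ M) (ξ : X.OplaxMonoidal) : Prop where
  unit_equivalence : E ξ.η
  tensor_equivalence : ∀ m n : AugmentedSimplexCategory, E (ξ.δ m n)

/-! ### Pointed spaces, pointed maps, and the wedge -/

/-- A topological space with a basepoint. -/
structure PointedTop where
  carrier : Type u
  [top : TopologicalSpace carrier]
  pt : carrier

namespace PointedTop

instance : CoeSort PointedTop.{u} (Type u) := ⟨PointedTop.carrier⟩

instance (X : PointedTop.{u}) : TopologicalSpace X := X.top

/-- The space of basepoint-preserving continuous maps from `X` to `Y`; as a subtype of `C(X, Y)`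
it carries the compact-open topology. -/
abbrev Map (X : PointedTop.{u}) (Y : PointedTop.{v}) : Type (max u v) :=
  {f : C(X, Y) // f X.pt = Y.pt}

/-- Composition of pointed maps, in diagrammatic order. -/
def Map.comp {X : PointedTop.{u}} {Y : PointedTop.{v}} {Z : PointedTop.{w}}
    (f : Map X Y) (g : Map Y Z) : Map X Z :=
  ⟨g.1.comp f.1, by rw [ContinuousMap.comp_apply, f.2, g.2]⟩

instance : Category PointedTop.{u} where
  Hom X Y := Map X Y
  id X := ⟨ContinuousMap.id X, rfl⟩
  comp f g := Map.comp f g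

theorem hom_ext {X Y : PointedTop.{u}} {f g : X ⟶ Y} (h : ∀ x, f.1 x = g.1 x) : f = g :=
  Subtype.ext (ContinuousMap.ext h)

@[simp]
theorem id_apply {X : PointedTop.{u}} (x : X) : (𝟙 X : X ⟶ X).1 x = x := rfl

@[simp]
theorem comp_apply {X Y Z : PointedTop.{u}} (f : X ⟶ Y) (g : Y ⟶ Z) (x : X) :
    (f ≫ g).1 x = g.1 (f.1 x) := rfl

/-- The one-point space. -/
def point : PointedTop.{u} := ⟨PUnit, PUnit.unit⟩

/-- The unique pointed map out of the one-point space. -/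
def fromPoint (X : PointedTop.{u}) : point.{u} ⟶ X := ⟨ContinuousMap.const _ X.pt, rfl⟩

/-- The relation on the disjoint union `X ⊕ Y` relating the two basepoints. -/
def WedgeRel (X Y : PointedTop.{u}) (a b : X ⊕ Y) : Prop :=
  a = Sum.inl X.pt ∧ b = Sum.inr Y.pt

/-- The wedge `X ∨ Y`: the disjoint union of `X` and `Y` with the two basepoints identified,
with the quotient topology. -/
def wedge (X Y : PointedTop.{u}) : PointedTop.{u} :=
  ⟨Quot (WedgeRel X Y), Quot.mk _ (Sum.inl X.pt)⟩

namespace wedge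

/-- The inclusion of the first summand. -/
def inl (X Y : PointedTop.{u}) : X ⟶ wedge X Y :=
  ⟨⟨fun x => Quot.mk _ (Sum.inl x), continuous_quot_mk.comp continuous_inl⟩, rfl⟩

/-- The inclusion of the second summand. -/
def inr (X Y : PointedTop.{u}) : Y ⟶ wedge X Y :=
  ⟨⟨fun y => Quot.mk _ (Sum.inr y), continuous_quot_mk.comp continuous_inr⟩,
    (Quot.sound ⟨rfl, rfl⟩).symm⟩

/-- The map out of the wedge given by pointed maps out of the two summands. -/
def desc {X Y Z : PointedTop.{u}} (f : X ⟶ Z) (g : Y ⟶ Z) : wedge X Y ⟶ Z :=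
  ⟨⟨Quot.lift (Sum.elim f.1 g.1) (by
      rintro _ _ ⟨rfl, rfl⟩
      exact f.2.trans g.2.symm),
    continuous_quot_lift _ (f.1.continuous.sumElim g.1.continuous)⟩, f.2⟩

@[simp]
theorem inl_desc {X Y Z : PointedTop.{u}} (f : X ⟶ Z) (g : Y ⟶ Z) :
    inl X Y ≫ desc f g = f := rfl

@[simp]
theorem inr_desc {X Y Z : PointedTop.{u}} (f : X ⟶ Z) (g : Y ⟶ Z) :
    inr X Y ≫ desc f g = g := rfl

@[simp]
theorem inl_desc_assoc {X Y Z T : PointedTop.{u}} (f : X ⟶ Z) (g : Y ⟶ Z) (h : Z ⟶ T) :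
    inl X Y ≫ desc f g ≫ h = f ≫ h := rfl

@[simp]
theorem inr_desc_assoc {X Y Z T : PointedTop.{u}} (f : X ⟶ Z) (g : Y ⟶ Z) (h : Z ⟶ T) :
    inr X Y ≫ desc f g ≫ h = g ≫ h := rfl

theorem hom_ext {X Y Z : PointedTop.{u}} {f g : wedge X Y ⟶ Z}
    (h₁ : inl X Y ≫ f = inl X Y ≫ g) (h₂ : inr X Y ≫ f = inr X Y ≫ g) : f = g := by
  apply PointedTop.hom_ext
  rintro ⟨x | y⟩
  · exact congrArg (fun k : X ⟶ Z => k.1 x) h₁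
  · exact congrArg (fun k : Y ⟶ Z => k.1 y) h₂

end wedge

theorem fromPoint_unique {X : PointedTop.{u}} (f g : point.{u} ⟶ X) : f = g :=
  PointedTop.hom_ext fun _ => f.2.trans g.2.symm

/-- The monoidal category `(Top_*, ∨)`: the tensor product is the wedge, the unit is the one-point
space, and the coherence isomorphisms are the evident ones. -/
instance : MonoidalCategoryStruct PointedTop.{u} where
  tensorObj := wedge
  tensorUnit := point
  tensorHom f g := wedge.desc (f ≫ wedge.inl _ _) (g ≫ wedge.inr _ _)
  whiskerLeft X _ _ g := wedge.desc (wedge.inl _ _) (g ≫ wedge.inr _ _)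
  whiskerRight f Y := wedge.desc (f ≫ wedge.inl _ _) (wedge.inr _ _)
  associator X Y Z :=
    { hom := wedge.desc (wedge.desc (wedge.inl _ _) (wedge.inl _ _ ≫ wedge.inr _ _))
        (wedge.inr _ _ ≫ wedge.inr _ _)
      inv := wedge.desc (wedge.inl _ _ ≫ wedge.inl _ _)
        (wedge.desc (wedge.inr _ _ ≫ wedge.inl _ _) (wedge.inr _ _))
      hom_inv_id := by
        apply wedge.hom_ext
        · apply wedge.hom_ext <;> simp
        · simp
      inv_hom_id := by
        apply wedge.hom_ext
        · simp
        · apply wedge.hom_ext <;> simp }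
  leftUnitor X :=
    { hom := wedge.desc (fromPoint X) (𝟙 X)
      inv := wedge.inr _ _
      hom_inv_id := by
        apply wedge.hom_ext
        · exact fromPoint_unique _ _
        · simp
      inv_hom_id := by simp }
  rightUnitor X :=
    { hom := wedge.desc (𝟙 X) (fromPoint X)
      inv := wedge.inl _ _
      hom_inv_id := by
        apply wedge.hom_ext
        · simp
        · exact fromPoint_unique _ _
      inv_hom_id := by simp }

instance : MonoidalCategory PointedTop.{u} :=
  MonoidalCategory.ofTensorHom
    (id_tensorHom_id := fun X Y => by
      apply wedge.hom_ext <;> rfl)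
    (id_tensorHom := fun X _ _ f => by
      apply wedge.hom_ext <;> rfl)
    (tensorHom_id := fun f Y => by
      apply wedge.hom_ext <;> rfl)
    (tensorHom_comp_tensorHom := fun f₁ f₂ g₁ g₂ => by
      apply wedge.hom_ext <;> rfl)
    (associator_naturality := fun f₁ f₂ f₃ => by
      apply wedge.hom_ext
      · apply wedge.hom_ext <;> rfl
      · rfl)
    (leftUnitor_naturality := fun f => by
      apply wedge.hom_ext
      · exact fromPoint_unique _ _
      · rfl)
    (rightUnitor_naturality := fun f => by
      apply wedge.hom_ext
      · rfl
      · exact fromPoint_unique _ _)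
    (pentagon := fun W X Y Z => by
      apply wedge.hom_ext
      · apply wedge.hom_ext
        · apply wedge.hom_ext <;> rfl
        · rfl
      · rfl)
    (triangle := fun X Y => by
      apply wedge.hom_ext
      · apply wedge.hom_ext
        · rfl
        · exact fromPoint_unique _ _
      · rfl)

/-- The pointed homotopy equivalences: pointed maps having an inverse up to homotopies that fix
the basepoint. -/
def homotopyEquivalences : MorphismProperty PointedTop.{u} := fun X Y f =>
  ∃ g : Y ⟶ X, (f ≫ g).1.HomotopicRel (𝟙 X : X ⟶ X).1 {X.pt} ∧
    (g ≫ f).1.HomotopicRel (𝟙 Y : Y ⟶ Y).1 {Y.pt}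

/-- The functor `Top_*(-, B)` from `Top_*ᵒᵖ` to `Top`: the value at `X` is the space of pointed
maps from `X` to `B` with the compact-open topology, and maps act by precomposition. -/
def mapsTo (B : PointedTop.{v}) : PointedTop.{u}ᵒᵖ ⥤ TopCat.{max u v} where
  obj X := TopCat.of (Map X.unop B)
  map f := TopCat.ofHom ⟨fun γ => Map.comp f.unop γ,
    Continuous.subtype_mk
      ((ContinuousMap.continuous_precomp f.unop.1).comp continuous_subtype_val) _⟩

/-- Postcomposition with a pointed map `g : B ⟶ B'`, as a natural transformation
`Top_*(-, B) ⟶ Top_*(-, B')`. -/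
def mapsToPostcomp {B B' : PointedTop.{v}} (g : B ⟶ B') :
    mapsTo.{u, v} B ⟶ mapsTo.{u, v} B' where
  app X := TopCat.ofHom ⟨fun γ => Map.comp γ g,
    Continuous.subtype_mk
      ((ContinuousMap.continuous_postcomp g.1).comp continuous_subtype_val) _⟩

/-- The circle `S¹`, with basepoint `1`. -/
def circle : PointedTop.{0} := ⟨Circle, 1⟩

/-- The loop space `ΩB = Top_*(S¹, B)`. -/
def loopSpace (B : PointedTop.{v}) : TopCat.{v} := (mapsTo.{0, v} B).obj (op circle)

end PointedTop

/-- The homotopy equivalences of topological spaces. -/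
def TopCat.homotopyEquivalences : MorphismProperty TopCat.{u} := fun X Y f =>
  ∃ e : ContinuousMap.HomotopyEquiv X Y, e.toFun = f.hom

/-! ### Finite ordinals and the order-theoretic duality -/

namespace AugmentedSimplexCategory

/-- The number of elements of a finite ordinal. -/
def card : AugmentedSimplexCategory → ℕ
  | .star => 0
  | .of x => x.len + 1

/-- The monotone map underlying a morphism of finite ordinals. -/
def orderHom : {x y : AugmentedSimplexCategory} → (x ⟶ y) → (Fin x.card →o Fin y.card)
  | .star, _, _ => ⟨fun i => Fin.elim0 i, fun i => Fin.elim0 i⟩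
  | .of _, .of _, f => (WithInitial.down f).toOrderHom
  | .of _, .star, f => (WithInitial.false_of_to_star f).elim

theorem orderHom_id (x : AugmentedSimplexCategory) : orderHom (𝟙 x) = OrderHom.id := by
  cases x with
  | star => ext i; exact Fin.elim0 i
  | of x => rfl

theorem orderHom_comp {x y z : AugmentedSimplexCategory} (f : x ⟶ y) (g : y ⟶ z) :
    orderHom (f ≫ g) = (orderHom g).comp (orderHom f) := by
  cases x with
  | star => ext i; exact Fin.elim0 i
  | of x =>
    cases y with
    | star => exact (WithInitial.false_of_to_star f).elim
    | of y =>
      cases z with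
      | star => exact (WithInitial.false_of_to_star g).elim
      | of z => rfl

theorem card_tensor (x y : AugmentedSimplexCategory) : card (x ⊗ y) = card x + card y := by
  cases x with
  | star => cases y <;> exact (Nat.zero_add _).symm
  | of x =>
    cases y with
    | star => rfl
    | of y =>
      change x.len + y.len + 1 + 1 = x.len + 1 + (y.len + 1)
      omega

end AugmentedSimplexCategory

/-- The endpoint-preserving monotone map `{0, …, n} → {0, …, m}` dual to a monotone map
`f : {0, …, m - 1} → {0, …, n - 1}`: it sends `j` to the number of `i` with `f i < j`. -/
def cut {m n : ℕ} (f : Fin m →o Fin n) (j : Fin (n + 1)) : Fin (m + 1) :=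
  ⟨(Finset.univ.filter fun i : Fin m => (f i : ℕ) < j).card,
    Nat.lt_succ_of_le ((Finset.card_le_univ _).trans_eq (Fintype.card_fin m))⟩

theorem lt_cut_iff {m n : ℕ} (f : Fin m →o Fin n) (j : Fin (n + 1)) (i : Fin m) :
    (i : ℕ) < cut f j ↔ (f i : ℕ) < j := by
  constructor
  · intro h
    by_contra hij
    have hsub : (Finset.univ.filter fun k : Fin m => (f k : ℕ) < j) ⊆ Finset.Iio i := by
      intro k hk
      rw [Finset.mem_filter] at hk
      rw [Finset.mem_Iio]
      by_contra hki
      exact hij (lt_of_le_of_lt (f.monotone (not_lt.mp hki)) hk.2)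
    have := Finset.card_le_card hsub
    rw [Fin.card_Iio] at this
    exact absurd h (not_lt.mpr this)
  · intro h
    have hsub : Finset.Iic i ⊆ (Finset.univ.filter fun k : Fin m => (f k : ℕ) < j) := by
      intro k hk
      rw [Finset.mem_Iic] at hk
      exact Finset.mem_filter.mpr ⟨Finset.mem_univ _, lt_of_le_of_lt (f.monotone hk) h⟩
    have := Finset.card_le_card hsub
    rw [Fin.card_Iic] at this
    exact this

theorem fin_eq_of_lt_iff {m : ℕ} {a b : Fin (m + 1)}
    (h : ∀ i : Fin m, (i : ℕ) < a ↔ (i : ℕ) < b) : a = b := by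
  rcases lt_trichotomy (a : ℕ) b with hab | hab | hab
  · exact absurd ((h ⟨a, by omega⟩).mpr hab) (lt_irrefl _)
  · exact Fin.ext hab
  · exact absurd ((h ⟨b, by omega⟩).mp hab) (lt_irrefl _)

theorem cut_id {n : ℕ} (j : Fin (n + 1)) : cut (OrderHom.id : Fin n →o Fin n) j = j :=
  fin_eq_of_lt_iff fun i => lt_cut_iff _ j i

theorem cut_comp {l m n : ℕ} (f : Fin l →o Fin m) (g : Fin m →o Fin n) (j : Fin (n + 1)) :
    cut (g.comp f) j = cut f (cut g j) :=
  fin_eq_of_lt_iff fun i => by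
    rw [lt_cut_iff, lt_cut_iff, lt_cut_iff, OrderHom.comp_coe, Function.comp_apply]

/-! ### Simplices with their vertices collapsed -/

/-- A point of the standard `n`-simplex is a vertex. -/
def IsVertex {n : ℕ} (s : stdSimplex ℝ (Fin (n + 1))) : Prop :=
  ∃ i, s = stdSimplex.vertex i

/-- The equivalence relation on the standard `n`-simplex identifying all vertices. -/
def vertexSetoid (n : ℕ) : Setoid (stdSimplex ℝ (Fin (n + 1))) where
  r s t := s = t ∨ (IsVertex s ∧ IsVertex t)
  iseqv :=
    { refl := fun _ => Or.inl rfl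
      symm := fun h => h.elim (fun h => Or.inl h.symm) fun h => Or.inr h.symm
      trans := by
        rintro s t r (rfl | ⟨hs, ht⟩) (rfl | ⟨ht', hr⟩)
        · exact Or.inl rfl
        · exact Or.inr ⟨ht', hr⟩
        · exact Or.inr ⟨hs, ht⟩
        · exact Or.inr ⟨hs, hr⟩ }

/-- The standard `n`-simplex with its `n + 1` vertices collapsed to a single point, which is the
basepoint, with the quotient topology. -/
def collapsedSimplex (n : ℕ) : PointedTop.{0} :=
  ⟨Quotient (vertexSetoid n), Quotient.mk _ (stdSimplex.vertex 0)⟩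

/-- The quotient map from the standard `n`-simplex to the collapsed simplex. -/
def collapse (n : ℕ) (s : stdSimplex ℝ (Fin (n + 1))) : collapsedSimplex n :=
  Quotient.mk (vertexSetoid n) s

/-- The pointed map of collapsed simplices induced by a map `φ` between the sets of vertices
(by affine extension). -/
def collapsedMap {m n : ℕ} (φ : Fin (m + 1) → Fin (n + 1)) :
    collapsedSimplex m ⟶ collapsedSimplex n :=
  ⟨⟨Quotient.map (stdSimplex.map φ) (by
      rintro s t (rfl | ⟨⟨i, rfl⟩, ⟨j, rfl⟩⟩)
      · exact Or.inl rfl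
      · exact Or.inr ⟨⟨φ i, stdSimplex.map_vertex φ i⟩, ⟨φ j, stdSimplex.map_vertex φ j⟩⟩),
    (stdSimplex.continuous_map φ).quotient_map' _⟩,
    Quotient.sound (Or.inr ⟨⟨φ 0, stdSimplex.map_vertex φ 0⟩, ⟨0, rfl⟩⟩)⟩

theorem collapsedMap_id (n : ℕ) : collapsedMap (id : Fin (n + 1) → Fin (n + 1)) = 𝟙 _ := by
  apply PointedTop.hom_ext
  rintro ⟨s⟩
  exact congrArg (collapse n) (stdSimplex.map_id_apply s)

theorem collapsedMap_comp {l m n : ℕ} (φ : Fin (l + 1) → Fin (m + 1))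
    (ψ : Fin (m + 1) → Fin (n + 1)) :
    collapsedMap (ψ ∘ φ) = collapsedMap φ ≫ collapsedMap ψ := by
  apply PointedTop.hom_ext
  rintro ⟨s⟩
  exact congrArg (collapse n) (stdSimplex.map_comp_apply φ ψ s).symm

/-! ### The functors -/

open AugmentedSimplexCategory

/-- The functor `W`, from finite ordinals to `Top_*ᵒᵖ`: `W(n)` is the collapsed `n`-simplex, and a
monotone map `f : m → n` acts by the simplicial operator `W(n) ⟶ W(m)` given on vertices by the
endpoint-preserving map `{0, …, n} → {0, …, m}` dual to `f`. -/
def collapsedSimplexFunctor : AugmentedSimplexCategory ⥤ PointedTop.{0}ᵒᵖ where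
  obj x := op (collapsedSimplex x.card)
  map f := (collapsedMap (cut (orderHom f))).op
  map_id x := by
    rw [orderHom_id, show cut (OrderHom.id : Fin x.card →o Fin x.card) = id from
      funext cut_id, collapsedMap_id, op_id]
  map_comp f g := by
    rw [orderHom_comp, show cut ((orderHom g).comp (orderHom f)) =
      cut (orderHom f) ∘ cut (orderHom g) from funext (cut_comp _ _), collapsedMap_comp, op_comp]

/-- The front face `W(m) ⟶ W(m + n)`, given on vertices by `i ↦ i`. -/
def frontFace (m n : AugmentedSimplexCategory) :
    collapsedSimplex m.card ⟶ collapsedSimplex (m ⊗ n).card :=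
  collapsedMap fun i => ⟨i, by have := card_tensor m n; omega⟩

/-- The back face `W(n) ⟶ W(m + n)`, given on vertices by `i ↦ m + i`. -/
def backFace (m n : AugmentedSimplexCategory) :
    collapsedSimplex n.card ⟶ collapsedSimplex (m ⊗ n).card :=
  collapsedMap fun i => ⟨m.card + i, by have := card_tensor m n; omega⟩

/-- The face inclusion `W(m) ∨ W(n) ⟶ W(m + n)`. -/
def faceInclusion (m n : AugmentedSimplexCategory) :
    PointedTop.wedge (collapsedSimplex m.card) (collapsedSimplex n.card) ⟶
      collapsedSimplex (m ⊗ n).card :=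
  PointedTop.wedge.desc (frontFace m n) (backFace m n)

/-- The one-element ordinal. -/
abbrev oneOrdinal : AugmentedSimplexCategory := .of (SimplexCategory.mk 0)

/-- The functor `X = Top_*(W(-), B)` from finite ordinals to `Top`. -/
def loopFunctor (B : PointedTop.{u}) : AugmentedSimplexCategory ⥤ TopCat.{u} :=
  collapsedSimplexFunctor ⋙ PointedTop.mapsTo.{0, u} B

/-- The natural transformation `Top_*(W(-), B) ⟶ Top_*(W(-), B')` induced by `g : B ⟶ B'`. -/
def loopFunctorMap {B B' : PointedTop.{u}} (g : B ⟶ B') : loopFunctor B ⟶ loopFunctor B' :=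
  Functor.whiskerLeft collapsedSimplexFunctor (PointedTop.mapsToPostcomp.{0, u} g)

/-- The parametrization `Δ¹ → S¹`, `t ↦ exp(2πi t₁)`, which collapses the two vertices to the
basepoint `1`. -/
def simplexToCircle (t : stdSimplex ℝ (Fin 2)) : Circle := Circle.exp (2 * Real.pi * t 1)

end

noncomputable section

/-! ### Ordinal sums and the dual vertex maps -/

namespace AugmentedSimplexCategory

/-! The colax axioms for `W` are identities between affine maps, hence between maps of vertices. The
dual vertex map is determined by the equivalence `i < cut f j ↔ f i < j` (`lt_cut_iff`), which
reduces naturality to inspecting the two summands of an ordinal sum. An isomorphism of finite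
ordinals preserves numerical values, so the associators and unitors are harmless.

The geometric point is that the front and back faces of a simplex share exactly one vertex, and
their union carries all the vertices. Let `d` be the weight before the common vertex minus the
weight after it. Where `d ≥ 0` the simplex is projected to the front face, where `d ≤ 0` to the back
face, and both projections are pulled to the common vertex as `d` tends to `0`. This gives a map
`toWedge` from the collapsed simplex to the wedge. Both composites with the face inclusion come from
self-maps of simplices that fix every vertex. By convexity, straight-line homotopies join these to
the identity and keep the vertices fixed, so they descend to the quotients. Hence the face inclusion
is a pointed homotopy equivalence (`homotopyEquivalences_fromWedge`).

For `Top_*(W(-), B)`, precomposition turns pointed homotopy equivalences into homotopy equivalences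
(`homotopyEquiv_precomp`), and maps out of a wedge form a product (`mapsToWedgeHomeomorph`). These
two facts need local compactness and separation, which follow from collapsed simplices being compact
Hausdorff. The colax structure is that of a composite of two colax functors, and compactness also
gives `W(1) ≅ S¹`. -/

theorem orderHom_inl (x y : AugmentedSimplexCategory) (i : Fin x.card) :
    (orderHom (inl x y) i : ℕ) = i := by
  cases x with
  | star => exact i.elim0
  | of x =>
    cases y with
    | star => rfl
    | of y => exact congrArg Fin.val (inl'_eval x y i)

theorem orderHom_inr (x y : AugmentedSimplexCategory) (i : Fin y.card) :
    (orderHom (inr x y) i : ℕ) = x.card + i := by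
  cases y with
  | star => exact i.elim0
  | of y =>
    cases x with
    | star => exact (Nat.zero_add _).symm
    | of x => exact congrArg Fin.val (inr'_eval x y i)

theorem eq_inl_or_eq_inr {x y : AugmentedSimplexCategory} (k : Fin (x ⊗ y).card) :
    (∃ i, k = orderHom (inl x y) i) ∨ ∃ i, k = orderHom (inr x y) i := by
  have hk := k.2.trans_eq (card_tensor x y)
  rcases lt_or_ge (k : ℕ) x.card with h | h
  · exact Or.inl ⟨⟨k, h⟩, Fin.ext (orderHom_inl x y ⟨k, h⟩).symm⟩
  · refine Or.inr ⟨⟨k - x.card, by omega⟩, Fin.ext ?_⟩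
    rw [orderHom_inr]
    exact (Nat.add_sub_cancel' h).symm

theorem orderHom_tensorHom_inl {x x' y y' : AugmentedSimplexCategory} (f : x ⟶ y) (g : x' ⟶ y')
    (i : Fin x.card) :
    (orderHom (f ⊗ₘ g) (orderHom (inl x x') i) : ℕ) = orderHom f i := by
  have h := congrArg (fun k => (orderHom k i : ℕ)) (inl_comp_tensorHom f g)
  simp only [orderHom_comp, OrderHom.comp_coe, Function.comp_apply] at h
  rw [h, orderHom_inl]

theorem orderHom_tensorHom_inr {x x' y y' : AugmentedSimplexCategory} (f : x ⟶ y) (g : x' ⟶ y')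
    (i : Fin x'.card) :
    (orderHom (f ⊗ₘ g) (orderHom (inr x x') i) : ℕ) = y.card + orderHom g i := by
  have h := congrArg (fun k => (orderHom k i : ℕ)) (inr_comp_tensorHom f g)
  simp only [orderHom_comp, OrderHom.comp_coe, Function.comp_apply] at h
  rw [h, orderHom_inr]

theorem orderHom_inv_hom {x y : AugmentedSimplexCategory} (e : x ≅ y) (i : Fin x.card) :
    orderHom e.inv (orderHom e.hom i) = i := by
  have h := congrArg (fun k => orderHom k i) e.hom_inv_id
  simp only [orderHom_comp, orderHom_id] at h
  exact h

theorem strictMono_orderHom_iso {x y : AugmentedSimplexCategory} (e : x ≅ y) :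
    StrictMono (orderHom e.hom) :=
  (orderHom e.hom).monotone.strictMono_of_injective
    (Function.LeftInverse.injective (orderHom_inv_hom e))

theorem le_of_strictMono_fin {m n : ℕ} {f : Fin m → Fin n} (hf : StrictMono f) (i : Fin m) :
    (i : ℕ) ≤ f i := by
  obtain ⟨k, hk⟩ := i
  induction k with
  | zero => exact Nat.zero_le _
  | succ k ih =>
    exact lt_of_le_of_lt (ih (by omega)) (hf (a := ⟨k, by omega⟩) (Fin.mk_lt_mk.2 k.lt_succ_self))

/-- A strictly monotone map of finite ordinals never decreases values; applying this to the
isomorphism and to its inverse gives both inequalities. It makes unfolding the coherence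
isomorphisms unnecessary. -/
theorem orderHom_iso {x y : AugmentedSimplexCategory} (e : x ≅ y) (i : Fin x.card) :
    (orderHom e.hom i : ℕ) = i := by
  refine le_antisymm ?_ (le_of_strictMono_fin (strictMono_orderHom_iso e) i)
  have h := le_of_strictMono_fin (strictMono_orderHom_iso e.symm) (orderHom e.hom i)
  rwa [Iso.symm_hom, orderHom_inv_hom] at h

theorem card_le_of_iso {x y : AugmentedSimplexCategory} (e : x ≅ y) : x.card ≤ y.card := by
  simpa using Fintype.card_le_of_injective _ (strictMono_orderHom_iso e).injective

theorem cut_iso {x y : AugmentedSimplexCategory} (e : x ≅ y) (j : Fin (y.card + 1)) :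
    (cut (orderHom e.hom) j : ℕ) = j := by
  have hxy : y.card ≤ x.card := card_le_of_iso e.symm
  rw [fin_eq_of_lt_iff (a := cut (orderHom e.hom) j) (b := ⟨j, by omega⟩) fun i => ?_]
  rw [lt_cut_iff, orderHom_iso]

/-- The vertices of the front face. -/
def frontVertex (x y : AugmentedSimplexCategory) (i : Fin (x.card + 1)) :
    Fin ((x ⊗ y).card + 1) :=
  ⟨i, by have := card_tensor x y; omega⟩

/-- The vertices of the back face. -/
def backVertex (x y : AugmentedSimplexCategory) (i : Fin (y.card + 1)) :
    Fin ((x ⊗ y).card + 1) :=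
  ⟨x.card + i, by have := card_tensor x y; omega⟩

/-- By `lt_cut_iff` it suffices to compare the elements below each side. On the left summand the
condition is the one for `f`. An element of the right summand has value at least `x.card` and image
at least `y.card`, so neither inequality can hold. -/
theorem cut_tensorHom_frontVertex {x x' y y' : AugmentedSimplexCategory} (f : x ⟶ y)
    (g : x' ⟶ y') (j : Fin (y.card + 1)) :
    cut (orderHom (f ⊗ₘ g)) (frontVertex y y' j) = frontVertex x x' (cut (orderHom f) j) := by
  refine fin_eq_of_lt_iff fun k => ?_
  rw [lt_cut_iff]
  rcases eq_inl_or_eq_inr k with ⟨i, rfl⟩ | ⟨i, rfl⟩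
  · rw [orderHom_tensorHom_inl, orderHom_inl]
    exact (lt_cut_iff _ _ _).symm
  · rw [orderHom_tensorHom_inr, orderHom_inr]
    simp only [frontVertex]
    omega

theorem cut_tensorHom_backVertex {x x' y y' : AugmentedSimplexCategory} (f : x ⟶ y)
    (g : x' ⟶ y') (j : Fin (y'.card + 1)) :
    cut (orderHom (f ⊗ₘ g)) (backVertex y y' j) = backVertex x x' (cut (orderHom g) j) := by
  refine fin_eq_of_lt_iff fun k => ?_
  rw [lt_cut_iff]
  rcases eq_inl_or_eq_inr k with ⟨i, rfl⟩ | ⟨i, rfl⟩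
  · rw [orderHom_tensorHom_inl, orderHom_inl]
    simp only [backVertex]
    omega
  · rw [orderHom_tensorHom_inr, orderHom_inr]
    simpa only [backVertex, Nat.add_lt_add_iff_left] using (lt_cut_iff _ _ _).symm

end AugmentedSimplexCategory

open AugmentedSimplexCategory

/-! ### The colax monoidal structure on `W` -/

theorem frontFace_comp_collapsedMap {x x' y y' : AugmentedSimplexCategory} (f : x ⟶ y)
    (g : x' ⟶ y') :
    frontFace y y' ≫ collapsedMap (cut (orderHom (f ⊗ₘ g))) =
      collapsedMap (cut (orderHom f)) ≫ frontFace x x' := by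
  refine (collapsedMap_comp _ _).symm.trans (Eq.trans ?_ (collapsedMap_comp _ _))
  exact congrArg collapsedMap (funext (cut_tensorHom_frontVertex f g))

theorem backFace_comp_collapsedMap {x x' y y' : AugmentedSimplexCategory} (f : x ⟶ y)
    (g : x' ⟶ y') :
    backFace y y' ≫ collapsedMap (cut (orderHom (f ⊗ₘ g))) =
      collapsedMap (cut (orderHom g)) ≫ backFace x x' := by
  refine (collapsedMap_comp _ _).symm.trans (Eq.trans ?_ (collapsedMap_comp _ _))
  exact congrArg collapsedMap (funext (cut_tensorHom_backVertex f g))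

theorem faceInclusion_natural {x x' y y' : AugmentedSimplexCategory} (f : x ⟶ y)
    (g : x' ⟶ y') :
    (collapsedMap (cut (orderHom f)) ⊗ₘ collapsedMap (cut (orderHom g))) ≫ faceInclusion x x' =
      faceInclusion y y' ≫ collapsedMap (cut (orderHom (f ⊗ₘ g))) := by
  apply PointedTop.wedge.hom_ext
  · exact (frontFace_comp_collapsedMap f g).symm
  · exact (backFace_comp_collapsedMap f g).symm

/-- On each of the three summands both composites are induced by vertex maps, with values `i`,
`x.card + i` and `x.card + y.card + i` respectively; `cut_iso` disposes of the associator. -/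
theorem faceInclusion_associator (x y z : AugmentedSimplexCategory) :
    (α_ (collapsedSimplex x.card) (collapsedSimplex y.card) (collapsedSimplex z.card)).inv ≫
        (faceInclusion x y ▷ collapsedSimplex z.card) ≫ faceInclusion (x ⊗ y) z =
      (collapsedSimplex x.card ◁ faceInclusion y z) ≫ faceInclusion x (y ⊗ z) ≫
        collapsedMap (cut (orderHom (α_ x y z).hom)) := by
  have hxy := card_tensor x y
  apply PointedTop.wedge.hom_ext
  · change frontFace x y ≫ frontFace (x ⊗ y) z = frontFace x (y ⊗ z) ≫ collapsedMap _
    refine (collapsedMap_comp _ _).symm.trans (Eq.trans ?_ (collapsedMap_comp _ _))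
    refine congrArg collapsedMap (funext fun i => Fin.ext ?_)
    exact (cut_iso (α_ x y z) (frontVertex x (y ⊗ z) i)).symm
  · apply PointedTop.wedge.hom_ext
    · change backFace x y ≫ frontFace (x ⊗ y) z =
        (frontFace y z ≫ backFace x (y ⊗ z)) ≫ collapsedMap _
      refine (collapsedMap_comp _ _).symm.trans (Eq.trans ?_ ((collapsedMap_comp _ _).trans
        (congrArg (· ≫ _) (collapsedMap_comp _ _))))
      refine congrArg collapsedMap (funext fun i => Fin.ext ?_)
      exact (cut_iso (α_ x y z) (backVertex x (y ⊗ z) (frontVertex y z i))).symm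
    · change backFace (x ⊗ y) z = (backFace y z ≫ backFace x (y ⊗ z)) ≫ collapsedMap _
      refine Eq.trans ?_ ((collapsedMap_comp _ _).trans
        (congrArg (· ≫ _) (collapsedMap_comp _ _)))
      refine congrArg collapsedMap (funext fun i => Fin.ext ?_)
      refine Eq.trans ?_ (cut_iso (α_ x y z) (backVertex x (y ⊗ z) (backVertex y z i))).symm
      change (x ⊗ y).card + (i : ℕ) = x.card + (y.card + i)
      omega

theorem backFace_unit (x : AugmentedSimplexCategory) :
    backFace (𝟙_ _) x ≫ collapsedMap (cut (orderHom (λ_ x).inv)) = 𝟙 _ := by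
  refine (collapsedMap_comp _ _).symm.trans (Eq.trans ?_ (collapsedMap_id _))
  refine congrArg collapsedMap (funext fun i => Fin.ext ?_)
  exact (cut_iso (λ_ x).symm _).trans (Nat.zero_add _)

theorem frontFace_unit (x : AugmentedSimplexCategory) :
    frontFace x (𝟙_ _) ≫ collapsedMap (cut (orderHom (ρ_ x).inv)) = 𝟙 _ := by
  refine (collapsedMap_comp _ _).symm.trans (Eq.trans ?_ (collapsedMap_id _))
  refine congrArg collapsedMap (funext fun i => Fin.ext ?_)
  exact cut_iso (ρ_ x).symm _

/-- The colax monoidal structure on `W` given by the inclusions of front and back faces. -/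
@[reducible]
def collapsedSimplexOplaxMonoidal : collapsedSimplexFunctor.OplaxMonoidal where
  η := (PointedTop.fromPoint _).op
  δ m n := (faceInclusion m n).op
  δ_natural_left f x := Quiver.Hom.unop_inj <| by
    have h := faceInclusion_natural f (𝟙 x)
    rw [orderHom_id, show cut (OrderHom.id : Fin x.card →o Fin x.card) = id from
      funext cut_id, collapsedMap_id, tensorHom_id] at h
    exact h
  δ_natural_right x f := Quiver.Hom.unop_inj <| by
    have h := faceInclusion_natural (𝟙 x) f
    rw [orderHom_id, show cut (OrderHom.id : Fin x.card →o Fin x.card) = id from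
      funext cut_id, collapsedMap_id, id_tensorHom] at h
    exact h
  oplax_associativity x y z := Quiver.Hom.unop_inj <| by
    have h := ((Category.assoc _ _ _).trans (faceInclusion_associator x y z)).trans
      (Category.assoc _ _ _).symm
    exact h
  oplax_left_unitality x := Quiver.Hom.unop_inj <| by
    apply PointedTop.wedge.hom_ext
    · exact PointedTop.fromPoint_unique _ _
    · exact (backFace_unit x).symm
  oplax_right_unitality x := Quiver.Hom.unop_inj <| by
    apply PointedTop.wedge.hom_ext
    · exact (frontFace_unit x).symm
    · exact PointedTop.fromPoint_unique _ _

end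

noncomputable section

open scoped unitInterval

/-! ### Pointed homotopies as maps into path spaces -/

namespace PointedTop

/-- The free path space of `Y`, based at the constant path: a pointed map into it is a pointed
homotopy. -/
def pathSpace (Y : PointedTop.{u}) : PointedTop.{u} := ⟨C(I, Y), ContinuousMap.const I Y.pt⟩

/-- The value of a path at a parameter. -/
def evalPath {Y : PointedTop.{u}} (γ : pathSpace Y) (s : I) : Y := ContinuousMap.toFun γ s

/-- In this form a homotopy is a pointed map out of `X`, so it can be built by the universal
property when `X` is a quotient or a wedge, without forming the product of a quotient map with the
interval. -/
theorem homotopicRel_of_pathSpace {X Y : PointedTop.{u}} {f g : X ⟶ Y} (H : X ⟶ pathSpace Y)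
    (h₀ : ∀ x, evalPath (H.1 x) 0 = f.1 x) (h₁ : ∀ x, evalPath (H.1 x) 1 = g.1 x) :
    f.1.HomotopicRel g.1 {X.pt} := by
  -- Uncurrying is continuous because the interval is locally compact.
  have hH : Continuous fun p : I × X => evalPath (H.1 p.2) p.1 :=
    (ContinuousMap.continuous_uncurry_of_continuous (H.1 : C(X, C(I, Y)))).comp continuous_swap
  refine ⟨{ toFun := fun p => evalPath (H.1 p.2) p.1
            continuous_toFun := hH
            map_zero_left := h₀
            map_one_left := h₁
            prop' := ?_ }⟩
  rintro t _ rfl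
  exact (congrArg (fun γ : pathSpace Y => evalPath γ t) H.2).trans f.2.symm

end PointedTop

/-! ### Segments and contractions in a simplex -/

namespace stdSimplex

variable {ι κ : Type*} [Fintype ι] [Fintype κ]

/-- The point dividing the segment from `x` to `y` in the ratio `s : 1 - s`. -/
def mix (s : I) (x y : stdSimplex ℝ ι) : stdSimplex ℝ ι :=
  ⟨(1 - (s : ℝ)) • ⇑x + (s : ℝ) • ⇑y,
    convex_stdSimplex ℝ ι x.2 y.2 (sub_nonneg.2 s.2.2) s.2.1 (sub_add_cancel _ _)⟩

theorem mix_zero (x y : stdSimplex ℝ ι) : mix 0 x y = x :=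
  Subtype.ext (by simp [mix]; rfl)

theorem mix_one (x y : stdSimplex ℝ ι) : mix 1 x y = y :=
  Subtype.ext (by simp [mix]; rfl)

theorem mix_self (s : I) (x : stdSimplex ℝ ι) : mix s x x = x :=
  Subtype.ext (by simp [mix, ← add_smul]; rfl)

theorem map_mix (φ : ι → κ) (s : I) (x y : stdSimplex ℝ ι) :
    map φ (mix s x y) = mix s (map φ x) (map φ y) := by
  apply Subtype.ext
  change FunOnFinite.linearMap ℝ ℝ φ ((1 - (s : ℝ)) • ⇑x + (s : ℝ) • ⇑y) = _
  rw [map_add, map_smul, map_smul]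
  rfl

theorem continuous_mix : Continuous fun p : I × stdSimplex ℝ ι × stdSimplex ℝ ι =>
    mix p.1 p.2.1 p.2.2 := by
  refine Continuous.subtype_mk ?_ _
  have h : Continuous fun x : stdSimplex ℝ ι => (x : ι → ℝ) := continuous_subtype_val
  have h₁ : Continuous fun p : I × stdSimplex ℝ ι × stdSimplex ℝ ι => (⇑p.2.1 : ι → ℝ) :=
    h.comp (continuous_fst.comp continuous_snd)
  have h₂ : Continuous fun p : I × stdSimplex ℝ ι × stdSimplex ℝ ι => (⇑p.2.2 : ι → ℝ) :=
    h.comp (continuous_snd.comp continuous_snd)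
  fun_prop

theorem continuous_coord (i : ι) : Continuous fun x : stdSimplex ℝ ι => x i :=
  (continuous_apply i).comp continuous_subtype_val

theorem map_const [DecidableEq κ] (k : κ) (x : stdSimplex ℝ ι) :
    map (fun _ => k) x = vertex k := by
  ext l
  rw [map_coe, FunOnFinite.linearMap_apply_apply, vertex_coe]
  rcases eq_or_ne k l with rfl | h
  · simp
  · simp [h]

theorem apply_ne_vertex [DecidableEq ι] {i j : ι} (h : i ≠ j) :
    (vertex i : stdSimplex ℝ ι) j = 0 := by
  rw [vertex_coe, Pi.single_eq_of_ne h.symm]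

theorem apply_vertex_self [DecidableEq ι] (i : ι) : (vertex i : stdSimplex ℝ ι) i = 1 := by
  rw [vertex_coe, Pi.single_eq_same]

/-- The nearest-point retraction of the real line onto the unit interval. -/
def clamp (x : ℝ) : I := Set.projIcc 0 1 zero_le_one x

theorem continuous_clamp : Continuous clamp := continuous_projIcc (h := zero_le_one)

theorem clamp_of_nonpos {x : ℝ} (hx : x ≤ 0) : clamp x = 0 := Set.projIcc_of_le_left _ hx

theorem clamp_one : clamp 1 = 1 := Set.projIcc_right _

/-- The map pulling every point towards the vertex `v`, the more so the closer it is to `v`. -/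
def pull [DecidableEq ι] (v : ι) : C(stdSimplex ℝ ι, stdSimplex ℝ ι) where
  toFun x := mix (clamp (1 - x v)) (vertex v) x
  continuous_toFun :=
    continuous_mix.comp ((continuous_clamp.comp
      (continuous_const.sub (continuous_coord v))).prodMk (continuous_const.prodMk continuous_id))

theorem pull_apply [DecidableEq ι] (v : ι) (x : stdSimplex ℝ ι) :
    pull v x = mix (clamp (1 - x v)) (vertex v) x := rfl

/-- At `v` the segment is degenerate; at any other vertex the coordinate at `v` is `0`, so the
parameter is `1`. -/
theorem pull_vertex [DecidableEq ι] (v i : ι) : pull v (vertex i) = vertex i := by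
  rw [pull_apply]
  rcases eq_or_ne i v with rfl | h
  · exact mix_self _ _
  · rw [apply_ne_vertex h, sub_zero, clamp_one]
    exact mix_one _ _

end stdSimplex

open stdSimplex

/-! ### Maps out of a collapsed simplex -/

theorem collapse_vertex {n : ℕ} (i : Fin (n + 1)) :
    collapse n (vertex i) = (collapsedSimplex n).pt :=
  Quotient.sound (Or.inr ⟨⟨i, rfl⟩, ⟨0, rfl⟩⟩)

theorem continuous_collapse (n : ℕ) : Continuous (collapse n) := continuous_quot_mk

/-- The pointed map out of a collapsed simplex given by a map sending the vertices to the
basepoint. -/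
def collapsedDesc {n : ℕ} {X : PointedTop.{0}} (f : stdSimplex ℝ (Fin (n + 1)) → X)
    (hf : Continuous f) (hv : ∀ i, f (vertex i) = X.pt) : collapsedSimplex n ⟶ X :=
  ⟨⟨Quotient.lift f (by
      rintro s t (rfl | ⟨⟨i, rfl⟩, ⟨j, rfl⟩⟩)
      · rfl
      · exact (hv i).trans (hv j).symm),
    hf.quotient_lift _⟩, hv 0⟩

/-- The pointed self-map of a collapsed simplex induced by a self-map of the simplex fixing the
vertices. -/
def collapsedSelfMap {n : ℕ} (f : C(stdSimplex ℝ (Fin (n + 1)), stdSimplex ℝ (Fin (n + 1))))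
    (hv : ∀ i, f (vertex i) = vertex i) : collapsedSimplex n ⟶ collapsedSimplex n :=
  collapsedDesc (fun x => collapse n (f x)) ((continuous_collapse n).comp f.continuous)
    fun i => by rw [hv, collapse_vertex]

/-- The straight-line homotopy from `collapsedSelfMap f` to the identity. -/
def collapsedSelfMapHomotopy {n : ℕ}
    (f : C(stdSimplex ℝ (Fin (n + 1)), stdSimplex ℝ (Fin (n + 1))))
    (hv : ∀ i, f (vertex i) = vertex i) :
    collapsedSimplex n ⟶ PointedTop.pathSpace (collapsedSimplex n) :=
  collapsedDesc
    (ContinuousMap.curry (⟨fun p => collapse n (mix p.2 (f p.1) p.1),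
      (continuous_collapse n).comp (continuous_mix.comp (continuous_snd.prodMk
        ((f.continuous.comp continuous_fst).prodMk continuous_fst)))⟩ :
        C(stdSimplex ℝ (Fin (n + 1)) × I, collapsedSimplex n)))
    (ContinuousMap.continuous _)
    fun i => ContinuousMap.ext fun s => by
      change collapse n (mix s (f (vertex i)) (vertex i)) = (collapsedSimplex n).pt
      rw [hv, mix_self, collapse_vertex]

theorem collapsedSelfMapHomotopy_zero {n : ℕ}
    (f : C(stdSimplex ℝ (Fin (n + 1)), stdSimplex ℝ (Fin (n + 1))))
    (hv : ∀ i, f (vertex i) = vertex i) (x : collapsedSimplex n) :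
    PointedTop.evalPath ((collapsedSelfMapHomotopy f hv).1 x) 0 =
      (collapsedSelfMap f hv).1 x := by
  obtain ⟨x⟩ := x
  exact congrArg (collapse n) (mix_zero _ _)

theorem collapsedSelfMapHomotopy_one {n : ℕ}
    (f : C(stdSimplex ℝ (Fin (n + 1)), stdSimplex ℝ (Fin (n + 1))))
    (hv : ∀ i, f (vertex i) = vertex i) (x : collapsedSimplex n) :
    PointedTop.evalPath ((collapsedSelfMapHomotopy f hv).1 x) 1 = x := by
  obtain ⟨x⟩ := x
  exact congrArg (collapse n) (mix_one _ _)

/-- The segment from `f v` to `v` is constant at each vertex `v`, so the straight-line homotopy in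
the convex simplex survives collapsing the vertices. -/
theorem collapsedSelfMap_homotopicRel_id {n : ℕ}
    (f : C(stdSimplex ℝ (Fin (n + 1)), stdSimplex ℝ (Fin (n + 1))))
    (hv : ∀ i, f (vertex i) = vertex i) :
    (collapsedSelfMap f hv).1.HomotopicRel (𝟙 (collapsedSimplex n) : _ ⟶ _).1
      {(collapsedSimplex n).pt} :=
  PointedTop.homotopicRel_of_pathSpace (collapsedSelfMapHomotopy f hv)
    (collapsedSelfMapHomotopy_zero f hv) (collapsedSelfMapHomotopy_one f hv)

/-- Pointed homotopies to the identity on both summands give one on the wedge. -/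
theorem wedge_homotopicRel_id {X Y : PointedTop.{u}} {f : X ⟶ X} {g : Y ⟶ Y}
    (H : X ⟶ PointedTop.pathSpace X) (K : Y ⟶ PointedTop.pathSpace Y)
    (H₀ : ∀ x, PointedTop.evalPath (H.1 x) 0 = f.1 x)
    (H₁ : ∀ x, PointedTop.evalPath (H.1 x) 1 = x)
    (K₀ : ∀ y, PointedTop.evalPath (K.1 y) 0 = g.1 y)
    (K₁ : ∀ y, PointedTop.evalPath (K.1 y) 1 = y) :
    (f ⊗ₘ g : X ⊗ Y ⟶ X ⊗ Y).1.HomotopicRel (𝟙 (X ⊗ Y) : _ ⟶ _).1 {(X ⊗ Y).pt} := by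
  -- The path space is functorial by postcomposition, so homotopies on the summands can be carried
  -- into the wedge.
  have push : ∀ {A B : PointedTop.{u}} (k : A ⟶ B),
      ∃ k' : PointedTop.pathSpace A ⟶ PointedTop.pathSpace B,
        ∀ (γ : PointedTop.pathSpace A) (s : I),
          PointedTop.evalPath (k'.1 γ) s = k.1 (PointedTop.evalPath γ s) := fun k =>
    ⟨⟨⟨fun γ : C(I, _) => k.1.comp γ, ContinuousMap.continuous_postcomp k.1⟩,
      ContinuousMap.ext fun _ => k.2⟩, fun _ _ => rfl⟩
  obtain ⟨i, hi⟩ := push (PointedTop.wedge.inl X Y)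
  obtain ⟨j, hj⟩ := push (PointedTop.wedge.inr X Y)
  refine PointedTop.homotopicRel_of_pathSpace (PointedTop.wedge.desc (H ≫ i) (K ≫ j)) ?_ ?_
  · rintro ⟨x | y⟩
    · exact (hi _ _).trans (congrArg _ (H₀ x))
    · exact (hj _ _).trans (congrArg _ (K₀ y))
  · rintro ⟨x | y⟩
    · exact (hi _ _).trans (congrArg _ (H₁ x))
    · exact (hj _ _).trans (congrArg _ (K₁ y))

/-! ### The union of the front and back faces as a deformation retract up to homotopy -/

section Retraction

variable {M N K : ℕ}

/-- The inclusion of the vertices of the front face. -/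
def frontIncl (h : K = M + N) (i : Fin (M + 1)) : Fin (K + 1) := ⟨i, by omega⟩

/-- The inclusion of the vertices of the back face. -/
def backIncl (h : K = M + N) (i : Fin (N + 1)) : Fin (K + 1) := ⟨M + i, by omega⟩

/-- The retraction onto the vertices of the front face, sending the others to the last one. -/
def frontRetr (M K : ℕ) (i : Fin (K + 1)) : Fin (M + 1) := ⟨min i M, by omega⟩

/-- The retraction onto the vertices of the back face, sending the others to the first one. -/
def backRetr (h : K = M + N) (i : Fin (K + 1)) : Fin (N + 1) := ⟨i - M, by omega⟩

theorem frontRetr_frontIncl (h : K = M + N) (t : stdSimplex ℝ (Fin (M + 1))) :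
    map (frontRetr M K) (map (frontIncl h) t) = t := by
  rw [map_comp_apply, show frontRetr M K ∘ frontIncl h = id from
    funext fun i => Fin.ext (min_eq_left (Nat.lt_succ_iff.1 i.2)), map_id_apply]

theorem backRetr_backIncl (h : K = M + N) (t : stdSimplex ℝ (Fin (N + 1))) :
    map (backRetr h) (map (backIncl h) t) = t := by
  rw [map_comp_apply, show backRetr h ∘ backIncl h = id from
    funext fun i => Fin.ext (Nat.add_sub_cancel_left _ _), map_id_apply]

theorem frontRetr_backIncl (h : K = M + N) (t : stdSimplex ℝ (Fin (N + 1))) :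
    map (frontRetr M K) (map (backIncl h) t) = vertex (Fin.last M) := by
  rw [map_comp_apply, show frontRetr M K ∘ backIncl h = fun _ => Fin.last M from
    funext fun i => Fin.ext (min_eq_right (Nat.le_add_right _ _)), stdSimplex.map_const]

theorem backRetr_frontIncl (h : K = M + N) (t : stdSimplex ℝ (Fin (M + 1))) :
    map (backRetr h) (map (frontIncl h) t) = vertex 0 := by
  rw [map_comp_apply, show backRetr h ∘ frontIncl h = fun _ => 0 from
    funext fun i => Fin.ext (Nat.sub_eq_zero_of_le (Nat.lt_succ_iff.1 i.2)), stdSimplex.map_const]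

theorem frontIncl_last (h : K = M + N) : frontIncl h (Fin.last M) = backIncl h 0 := rfl

/-- The total weight of the vertices before the common vertex of the two faces, minus the total
weight of those after it. -/
def weightDiff (h : K = M + N) (t : stdSimplex ℝ (Fin (K + 1))) : ℝ :=
  map (backRetr h) t 0 - map (frontRetr M K) t (Fin.last M)

theorem continuous_weightDiff (h : K = M + N) : Continuous (weightDiff h) :=
  ((continuous_coord _).comp (continuous_map _)).sub ((continuous_coord _).comp (continuous_map _))

theorem weightDiff_frontIncl (h : K = M + N) (t : stdSimplex ℝ (Fin (M + 1))) :
    weightDiff h (map (frontIncl h) t) = 1 - t (Fin.last M) := by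
  rw [weightDiff, backRetr_frontIncl, frontRetr_frontIncl, apply_vertex_self]

theorem weightDiff_backIncl (h : K = M + N) (t : stdSimplex ℝ (Fin (N + 1))) :
    weightDiff h (map (backIncl h) t) = -(1 - t 0) := by
  rw [weightDiff, backRetr_backIncl, frontRetr_backIncl, apply_vertex_self, neg_sub]

/-- The projection of the simplex to its front face, contracting to the last vertex where the
weight of the back face predominates. -/
def frontProj (h : K = M + N) (t : stdSimplex ℝ (Fin (K + 1))) : stdSimplex ℝ (Fin (M + 1)) :=
  mix (clamp (weightDiff h t)) (vertex (Fin.last M)) (map (frontRetr M K) t)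

/-- The projection of the simplex to its back face, contracting to the first vertex where the
weight of the front face predominates. -/
def backProj (h : K = M + N) (t : stdSimplex ℝ (Fin (K + 1))) : stdSimplex ℝ (Fin (N + 1)) :=
  mix (clamp (-weightDiff h t)) (vertex 0) (map (backRetr h) t)

theorem continuous_frontProj (h : K = M + N) : Continuous (frontProj h) :=
  continuous_mix.comp ((continuous_clamp.comp (continuous_weightDiff h)).prodMk
    (continuous_const.prodMk (continuous_map _)))

theorem continuous_backProj (h : K = M + N) : Continuous (backProj h) :=
  continuous_mix.comp ((continuous_clamp.comp (continuous_weightDiff h).neg).prodMk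
    (continuous_const.prodMk (continuous_map _)))

theorem frontProj_of_nonpos (h : K = M + N) {t : stdSimplex ℝ (Fin (K + 1))}
    (ht : weightDiff h t ≤ 0) : frontProj h t = vertex (Fin.last M) := by
  rw [frontProj, clamp_of_nonpos ht]
  exact mix_zero _ _

theorem backProj_of_nonneg (h : K = M + N) {t : stdSimplex ℝ (Fin (K + 1))}
    (ht : 0 ≤ weightDiff h t) : backProj h t = vertex 0 := by
  rw [backProj, clamp_of_nonpos (neg_nonpos.2 ht)]
  exact mix_zero _ _

theorem frontProj_frontIncl (h : K = M + N) (t : stdSimplex ℝ (Fin (M + 1))) :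
    frontProj h (map (frontIncl h) t) = pull (Fin.last M) t := by
  rw [frontProj, weightDiff_frontIncl, frontRetr_frontIncl]
  rfl

theorem backProj_backIncl (h : K = M + N) (t : stdSimplex ℝ (Fin (N + 1))) :
    backProj h (map (backIncl h) t) = pull 0 t := by
  rw [backProj, weightDiff_backIncl, backRetr_backIncl, neg_neg]
  rfl

/-- The self-map of the simplex contracting it to the union of the front and back faces. -/
def facesMap (h : K = M + N) : C(stdSimplex ℝ (Fin (K + 1)), stdSimplex ℝ (Fin (K + 1))) where
  toFun t := mix (clamp (weightDiff h t))
    (map (backIncl h) (backProj h t)) (map (frontIncl h) (map (frontRetr M K) t))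
  continuous_toFun :=
    continuous_mix.comp ((continuous_clamp.comp (continuous_weightDiff h)).prodMk
      (((continuous_map _).comp (continuous_backProj h)).prodMk
        ((continuous_map _).comp (continuous_map _))))

theorem facesMap_apply (h : K = M + N) (t : stdSimplex ℝ (Fin (K + 1))) :
    facesMap h t = mix (clamp (weightDiff h t))
      (map (backIncl h) (backProj h t)) (map (frontIncl h) (map (frontRetr M K) t)) := rfl

/-- The single formula for `facesMap` makes continuity immediate. Here its back endpoint is the
common vertex, so the whole segment lies in the front face. -/
theorem facesMap_of_nonneg (h : K = M + N) {t : stdSimplex ℝ (Fin (K + 1))}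
    (ht : 0 ≤ weightDiff h t) : facesMap h t = map (frontIncl h) (frontProj h t) := by
  rw [facesMap_apply]
  rw [backProj_of_nonneg h ht, map_vertex, ← frontIncl_last, ← map_vertex, ← map_mix]
  rfl

theorem facesMap_of_nonpos (h : K = M + N) {t : stdSimplex ℝ (Fin (K + 1))}
    (ht : weightDiff h t ≤ 0) : facesMap h t = map (backIncl h) (backProj h t) := by
  rw [facesMap_apply]
  rw [clamp_of_nonpos ht]
  exact mix_zero _ _

theorem facesMap_frontIncl (h : K = M + N) (t : stdSimplex ℝ (Fin (M + 1))) :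
    facesMap h (map (frontIncl h) t) = map (frontIncl h) (pull (Fin.last M) t) := by
  rw [facesMap_of_nonneg, frontProj_frontIncl]
  rw [weightDiff_frontIncl]
  exact sub_nonneg.2 (le_one _ _)

theorem facesMap_backIncl (h : K = M + N) (t : stdSimplex ℝ (Fin (N + 1))) :
    facesMap h (map (backIncl h) t) = map (backIncl h) (pull 0 t) := by
  rw [facesMap_of_nonpos, backProj_backIncl]
  rw [weightDiff_backIncl]
  exact neg_nonpos.2 (sub_nonneg.2 (le_one _ _))

theorem eq_frontIncl_or_backIncl (h : K = M + N) (k : Fin (K + 1)) :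
    (∃ i, k = frontIncl h i) ∨ ∃ i, k = backIncl h i := by
  rcases le_or_gt (k : ℕ) M with hk | hk
  · exact Or.inl ⟨⟨k, by omega⟩, rfl⟩
  · exact Or.inr ⟨⟨k - M, by omega⟩, Fin.ext (Nat.add_sub_cancel' hk.le).symm⟩

theorem facesMap_vertex (h : K = M + N) (k : Fin (K + 1)) :
    facesMap h (vertex k) = vertex k := by
  rcases eq_frontIncl_or_backIncl h k with ⟨i, rfl⟩ | ⟨i, rfl⟩
  · rw [← map_vertex, facesMap_frontIncl, pull_vertex]
  · rw [← map_vertex, facesMap_backIncl, pull_vertex]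

/-- The map from the simplex to the wedge of its collapsed front and back faces. -/
def toWedgeFun (h : K = M + N) (t : stdSimplex ℝ (Fin (K + 1))) :
    PointedTop.wedge (collapsedSimplex M) (collapsedSimplex N) :=
  if 0 ≤ weightDiff h t then (PointedTop.wedge.inl _ _).1 (collapse M (frontProj h t))
  else (PointedTop.wedge.inr _ _).1 (collapse N (backProj h t))

theorem toWedgeFun_of_nonneg (h : K = M + N) {t : stdSimplex ℝ (Fin (K + 1))}
    (ht : 0 ≤ weightDiff h t) :
    toWedgeFun h t = (PointedTop.wedge.inl _ _).1 (collapse M (frontProj h t)) := if_pos ht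

theorem toWedgeFun_of_nonpos (h : K = M + N) {t : stdSimplex ℝ (Fin (K + 1))}
    (ht : weightDiff h t ≤ 0) :
    toWedgeFun h t = (PointedTop.wedge.inr _ _).1 (collapse N (backProj h t)) := by
  rcases ht.lt_or_eq with ht | ht
  · exact if_neg ht.not_ge
  -- When the weights balance, both projections are the common vertex, which represents the
  -- basepoint of the wedge.
  · rw [toWedgeFun_of_nonneg h ht.ge, frontProj_of_nonpos h ht.le, backProj_of_nonneg h ht.ge,
      collapse_vertex, collapse_vertex]
    exact (PointedTop.wedge.inr _ _).2.symm

theorem continuous_toWedgeFun (h : K = M + N) : Continuous (toWedgeFun h) := by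
  refine Continuous.if_le
    ((PointedTop.wedge.inl _ _).1.continuous.comp
      ((continuous_collapse M).comp (continuous_frontProj h)))
    ((PointedTop.wedge.inr _ _).1.continuous.comp
      ((continuous_collapse N).comp (continuous_backProj h)))
    continuous_const (continuous_weightDiff h) fun t ht => ?_
  exact (toWedgeFun_of_nonneg h ht.le).symm.trans (toWedgeFun_of_nonpos h ht.ge)

theorem toWedgeFun_frontIncl (h : K = M + N) (t : stdSimplex ℝ (Fin (M + 1))) :
    toWedgeFun h (map (frontIncl h) t) =
      (PointedTop.wedge.inl _ _).1 (collapse M (pull (Fin.last M) t)) := by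
  rw [toWedgeFun_of_nonneg, frontProj_frontIncl]
  rw [weightDiff_frontIncl]
  exact sub_nonneg.2 (le_one _ _)

theorem toWedgeFun_backIncl (h : K = M + N) (t : stdSimplex ℝ (Fin (N + 1))) :
    toWedgeFun h (map (backIncl h) t) =
      (PointedTop.wedge.inr _ _).1 (collapse N (pull 0 t)) := by
  rw [toWedgeFun_of_nonpos, backProj_backIncl]
  rw [weightDiff_backIncl]
  exact neg_nonpos.2 (sub_nonneg.2 (le_one _ _))

theorem toWedgeFun_vertex (h : K = M + N) (k : Fin (K + 1)) :
    toWedgeFun h (vertex k) = (PointedTop.wedge (collapsedSimplex M) (collapsedSimplex N)).pt := by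
  rcases eq_frontIncl_or_backIncl h k with ⟨i, rfl⟩ | ⟨i, rfl⟩
  · rw [← map_vertex, toWedgeFun_frontIncl, pull_vertex, collapse_vertex]
    exact (PointedTop.wedge.inl _ _).2
  · rw [← map_vertex, toWedgeFun_backIncl, pull_vertex, collapse_vertex]
    exact (PointedTop.wedge.inr _ _).2

/-- The homotopy inverse of the inclusion of the wedge of the front and back faces. -/
def toWedge (h : K = M + N) :
    collapsedSimplex K ⟶ PointedTop.wedge (collapsedSimplex M) (collapsedSimplex N) :=
  collapsedDesc (toWedgeFun h) (continuous_toWedgeFun h) (toWedgeFun_vertex h)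

/-- The inclusion of the wedge of the front and back faces. -/
def fromWedge (h : K = M + N) :
    PointedTop.wedge (collapsedSimplex M) (collapsedSimplex N) ⟶ collapsedSimplex K :=
  PointedTop.wedge.desc (collapsedMap (frontIncl h)) (collapsedMap (backIncl h))

/-- On a face, the weight difference is, up to sign, one minus the coordinate at the common vertex.
The composite is therefore not the identity but `pull` on each summand. -/
theorem fromWedge_toWedge (h : K = M + N) :
    fromWedge h ≫ toWedge h =
      (collapsedSelfMap (pull (Fin.last M)) (pull_vertex _) ⊗ₘ
        collapsedSelfMap (pull 0) (pull_vertex _)) := by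
  apply PointedTop.wedge.hom_ext
  · apply PointedTop.hom_ext
    rintro ⟨t⟩
    exact toWedgeFun_frontIncl h t
  · apply PointedTop.hom_ext
    rintro ⟨t⟩
    exact toWedgeFun_backIncl h t

theorem toWedge_fromWedge (h : K = M + N) :
    toWedge h ≫ fromWedge h = collapsedSelfMap (facesMap h) (facesMap_vertex h) := by
  apply PointedTop.hom_ext
  rintro ⟨t⟩
  change (fromWedge h).1 (toWedgeFun h t) = collapse K (facesMap h t)
  rcases le_total 0 (weightDiff h t) with ht | ht
  · rw [toWedgeFun_of_nonneg h ht, facesMap_of_nonneg h ht]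
    rfl
  · rw [toWedgeFun_of_nonpos h ht, facesMap_of_nonpos h ht]
    rfl

theorem homotopyEquivalences_fromWedge (h : K = M + N) :
    PointedTop.homotopyEquivalences (fromWedge h) := by
  refine ⟨toWedge h, ?_, ?_⟩
  · rw [fromWedge_toWedge]
    exact wedge_homotopicRel_id (collapsedSelfMapHomotopy (pull (Fin.last M)) (pull_vertex _))
      (collapsedSelfMapHomotopy (pull 0) (pull_vertex _))
      (collapsedSelfMapHomotopy_zero _ (pull_vertex _))
      (collapsedSelfMapHomotopy_one _ (pull_vertex _))
      (collapsedSelfMapHomotopy_zero _ (pull_vertex _))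
      (collapsedSelfMapHomotopy_one _ (pull_vertex _))
  · rw [toWedge_fromWedge]
    exact collapsedSelfMap_homotopicRel_id _ _

end Retraction

/-! ### `W` is a homotopy monoid -/

theorem homotopyEquivalences_faceInclusion (m n : AugmentedSimplexCategory) :
    PointedTop.homotopyEquivalences (faceInclusion m n) :=
  homotopyEquivalences_fromWedge (AugmentedSimplexCategory.card_tensor m n)

theorem homotopyEquivalences_fromPoint_collapsedSimplex_zero :
    PointedTop.homotopyEquivalences (PointedTop.fromPoint (collapsedSimplex 0)) := by
  have h : ∀ x : collapsedSimplex 0, (collapsedSimplex 0).pt = x := by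
    rintro ⟨x⟩
    exact congrArg (collapse 0) (Subsingleton.elim _ _)
  let r : collapsedSimplex 0 ⟶ PointedTop.point :=
    ⟨ContinuousMap.const _ PUnit.unit, rfl⟩
  refine ⟨r, ?_, ?_⟩
  · rw [PointedTop.fromPoint_unique (PointedTop.fromPoint _ ≫ r) (𝟙 _)]
    exact .refl _
  · rw [show r ≫ PointedTop.fromPoint (collapsedSimplex 0) = 𝟙 _ from PointedTop.hom_ext h]
    exact .refl _

theorem isHomotopyMonoid_collapsedSimplexFunctor :
    IsHomotopyMonoid PointedTop.homotopyEquivalences.op collapsedSimplexFunctor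
      collapsedSimplexOplaxMonoidal where
  unit_equivalence := homotopyEquivalences_fromPoint_collapsedSimplex_zero
  tensor_equivalence := homotopyEquivalences_faceInclusion

end

noncomputable section

open scoped unitInterval
open stdSimplex

/-! ### Collapsed simplices and their wedges are compact Hausdorff -/

section Separation

variable {ι : Type*} [Fintype ι] {n : ℕ}

/-- A function on the simplex that vanishes exactly at the vertices. -/
def vertexDefect (t : stdSimplex ℝ ι) : ℝ := 1 - ∑ i, t i ^ 2

theorem continuous_vertexDefect : Continuous (vertexDefect (ι := ι)) :=
  continuous_const.sub (continuous_finsetSum _ fun i _ => (continuous_coord i).pow 2)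

theorem vertexDefect_vertex [DecidableEq ι] (i : ι) : vertexDefect (vertex i) = 0 := by
  rw [vertexDefect, Finset.sum_eq_single i]
  · rw [apply_vertex_self, one_pow, sub_self]
  · intro j _ hj
    rw [apply_ne_vertex hj.symm]
    norm_num
  · simp

theorem isVertex_of_vertexDefect_eq_zero {t : stdSimplex ℝ (Fin (n + 1))}
    (ht : vertexDefect t = 0) : IsVertex t := by
  -- As the coordinates sum to one, the defect is a sum of the nonnegative terms `t i * (1 - t i)`;
  -- its vanishing forces every coordinate to be `0` or `1`.
  have hsum : ∑ i, t i * (1 - t i) = 0 := by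
    have h : vertexDefect t = ∑ i, t i - ∑ i, t i ^ 2 := by rw [sum_eq_one, vertexDefect]
    rw [← ht, h, ← Finset.sum_sub_distrib]
    refine Finset.sum_congr rfl fun i _ => by ring
  have hz : ∀ i, t i * (1 - t i) = 0 := fun i =>
    (Finset.sum_eq_zero_iff_of_nonneg fun j _ =>
      mul_nonneg (zero_le t j) (sub_nonneg.2 (le_one t j))).1 hsum i (Finset.mem_univ i)
  obtain ⟨i, hi⟩ : ∃ i, t i ≠ 0 := by
    by_contra! h
    simpa [h] using sum_eq_one t
  have hi1 : t i = 1 := (sub_eq_zero.1 ((mul_eq_zero.1 (hz i)).resolve_left hi)).symm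
  refine ⟨i, stdSimplex.ext (funext fun j => ?_)⟩
  rcases eq_or_ne i j with rfl | hij
  · rw [hi1, apply_vertex_self]
  · rw [apply_ne_vertex hij]
    refine le_antisymm ?_ (zero_le t j)
    have hle : t i + t j ≤ 1 := by
      rw [← sum_eq_one t, ← Finset.sum_pair hij]
      exact Finset.sum_le_sum_of_subset_of_nonneg (Finset.subset_univ _) fun k _ _ => zero_le t k
    linarith

/-- Coordinates on the simplex, rescaled so as to vanish at the vertices. -/
def collapsedCoords (n : ℕ) : collapsedSimplex n → ℝ × (Fin (n + 1) → ℝ) :=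
  Quotient.lift (fun t : stdSimplex ℝ (Fin (n + 1)) =>
    (vertexDefect t, fun i => vertexDefect t * t i)) (by
      rintro s t (rfl | ⟨⟨i, rfl⟩, ⟨j, rfl⟩⟩)
      · rfl
      · simp only [vertexDefect_vertex, zero_mul])

theorem continuous_collapsedCoords : Continuous (collapsedCoords n) :=
  (continuous_vertexDefect.prodMk (continuous_pi fun i =>
    continuous_vertexDefect.mul (continuous_coord i))).quotient_lift _

/-- If the defect is nonzero, dividing by it recovers the point; if it is zero, both points are
vertices and are identified. A continuous injection into a Hausdorff space then gives separation. -/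
theorem injective_collapsedCoords : Function.Injective (collapsedCoords n) := by
  rintro ⟨s⟩ ⟨t⟩ h
  have h₁ : vertexDefect s = vertexDefect t := congrArg Prod.fst h
  have h₂ : ∀ i, vertexDefect s * s i = vertexDefect t * t i :=
    fun i => congrFun (congrArg Prod.snd h) i
  apply Quotient.sound
  by_cases hs : vertexDefect s = 0
  · exact Or.inr ⟨isVertex_of_vertexDefect_eq_zero hs,
      isVertex_of_vertexDefect_eq_zero (h₁ ▸ hs)⟩
  · refine Or.inl (stdSimplex.ext (funext fun i => mul_left_cancel₀ hs ?_))
    rw [h₂, h₁]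

instance : T2Space (collapsedSimplex n) :=
  T2Space.of_injective_continuous injective_collapsedCoords continuous_collapsedCoords

instance : CompactSpace (collapsedSimplex n) :=
  inferInstanceAs (CompactSpace (Quotient (vertexSetoid n)))

end Separation

namespace PointedTop

variable {X Y : PointedTop.{u}}

/-- The pointed map constant at the basepoint. -/
def constPt (X : PointedTop.{u}) (Y : PointedTop.{v}) : Map X Y :=
  ⟨ContinuousMap.const _ Y.pt, rfl⟩

/-- The projection of the wedge to its first summand. -/
def wedge.fst (X Y : PointedTop.{u}) : wedge X Y ⟶ X := wedge.desc (𝟙 X) (constPt Y X)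

/-- The projection of the wedge to its second summand. -/
def wedge.snd (X Y : PointedTop.{u}) : wedge X Y ⟶ Y := wedge.desc (constPt X Y) (𝟙 Y)

theorem wedge.injective_fst_snd (X Y : PointedTop.{u}) :
    Function.Injective fun x : wedge X Y => ((wedge.fst X Y).1 x, (wedge.snd X Y).1 x) := by
  have key : ∀ (x : X) (y : Y), x = X.pt → Y.pt = y →
      (wedge.inl X Y).1 x = (wedge.inr X Y).1 y := by
    rintro _ _ rfl rfl
    exact (wedge.inl X Y).2.trans (wedge.inr X Y).2.symm
  rintro ⟨x | y⟩ ⟨x' | y'⟩ h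
  · exact congrArg (wedge.inl X Y).1 (congrArg Prod.fst h)
  · exact key x y' (congrArg Prod.fst h) (congrArg Prod.snd h)
  · exact (key x' y (congrArg Prod.fst h).symm (congrArg Prod.snd h).symm).symm
  · exact congrArg (wedge.inr X Y).1 (congrArg Prod.snd h)

instance [T2Space X] [T2Space Y] : T2Space (wedge X Y) :=
  T2Space.of_injective_continuous (wedge.injective_fst_snd X Y)
    ((wedge.fst X Y).1.continuous.prodMk (wedge.snd X Y).1.continuous)

instance [CompactSpace X] [CompactSpace Y] : CompactSpace (wedge X Y) :=
  inferInstanceAs (CompactSpace (Quot (WedgeRel X Y)))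

/-! ### Spaces of pointed maps -/


/-- The map out of the wedge given by pointed maps out of the two summands, possibly into a
different universe. -/
def Map.wedgeDesc {B : PointedTop.{v}} (f : Map X B) (g : Map Y B) : Map (wedge X Y) B :=
  ⟨⟨Quot.lift (Sum.elim f.1 g.1) (by
      rintro _ _ ⟨rfl, rfl⟩
      exact f.2.trans g.2.symm),
    continuous_quot_lift _ (f.1.continuous.sumElim g.1.continuous)⟩, f.2⟩

/-- By currying it is enough that evaluation is jointly continuous. The two summands are closed in
the wedge, being preimages of basepoints under the projections, and on each of them evaluation is
that of a single locally compact factor. -/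
theorem Map.continuous_wedgeDesc [T1Space X] [T1Space Y] [LocallyCompactSpace X]
    [LocallyCompactSpace Y] (B : PointedTop.{v}) :
    Continuous fun p : Map X B × Map Y B => Map.wedgeDesc p.1 p.2 := by
  let Z := Map X B × Map Y B
  let F : Z × wedge X Y → B := fun q => (Map.wedgeDesc q.1.1 q.1.2).1 q.2
  have hP : IsClosed {q : Z × wedge X Y | (wedge.snd X Y).1 q.2 = Y.pt} :=
    isClosed_singleton.preimage ((wedge.snd X Y).1.continuous.comp continuous_snd)
  have hQ : IsClosed {q : Z × wedge X Y | (wedge.fst X Y).1 q.2 = X.pt} :=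
    isClosed_singleton.preimage ((wedge.fst X Y).1.continuous.comp continuous_snd)
  have hF₁ : Continuous fun q : Z × wedge X Y => q.1.1.1 ((wedge.fst X Y).1 q.2) :=
    (continuous_subtype_val.comp (continuous_fst.comp continuous_fst)).eval
      ((wedge.fst X Y).1.continuous.comp continuous_snd)
  have hF₂ : Continuous fun q : Z × wedge X Y => q.1.2.1 ((wedge.snd X Y).1 q.2) :=
    (continuous_subtype_val.comp (continuous_snd.comp continuous_fst)).eval
      ((wedge.snd X Y).1.continuous.comp continuous_snd)
  have h₁ : ∀ q : Z × wedge X Y, (wedge.snd X Y).1 q.2 = Y.pt →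
      F q = q.1.1.1 ((wedge.fst X Y).1 q.2) := by
    rintro ⟨p, ⟨x | y⟩⟩ h
    · rfl
    · obtain rfl : y = Y.pt := h
      exact p.2.2.trans p.1.2.symm
  have h₂ : ∀ q : Z × wedge X Y, (wedge.fst X Y).1 q.2 = X.pt →
      F q = q.1.2.1 ((wedge.snd X Y).1 q.2) := by
    rintro ⟨p, ⟨x | y⟩⟩ h
    · obtain rfl : x = X.pt := h
      exact p.1.2.trans p.2.2.symm
    · rfl
  have hF : Continuous F := by
    rw [← continuousOn_univ]
    have hu : {q : Z × wedge X Y | (wedge.snd X Y).1 q.2 = Y.pt} ∪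
        {q : Z × wedge X Y | (wedge.fst X Y).1 q.2 = X.pt} = Set.univ := by
      refine Set.eq_univ_of_forall ?_
      rintro ⟨p, ⟨x | y⟩⟩
      · exact Or.inl rfl
      · exact Or.inr rfl
    rw [← hu]
    exact (hF₁.continuousOn.congr h₁).union_of_isClosed (hF₂.continuousOn.congr h₂) hP hQ
  exact Continuous.subtype_mk (ContinuousMap.curry ⟨F, hF⟩).continuous _

/-- A pointed homotopy induces a homotopy between the maps given by precomposition. -/
theorem homotopic_precomp [LocallyCompactSpace X] [LocallyCompactSpace Y] {f g : X ⟶ Y}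
    (h : f.1.HomotopicRel g.1 {X.pt}) (B : PointedTop.{v}) :
    ((mapsTo B).map f.op).hom.Homotopic ((mapsTo B).map g.op).hom := by
  obtain ⟨H⟩ := h
  have hH : ∀ s : I, H (s, X.pt) = Y.pt := fun s => (H.prop s X.pt rfl).trans f.2
  let K : C(I × Map Y B, Map X B) :=
    ⟨fun p => ⟨p.2.1.comp (H.toContinuousMap.curry p.1), 
        (congrArg p.2.1 (hH p.1)).trans p.2.2⟩,
      -- Composition is jointly continuous because the middle space `Y` is locally compact.
      Continuous.subtype_mk (ContinuousMap.continuous_comp'.comp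
        ((H.toContinuousMap.curry.continuous.comp continuous_fst).prodMk
          (continuous_subtype_val.comp continuous_snd))) _⟩
  refine ⟨{ toFun := K
            continuous_toFun := K.continuous
            map_zero_left := fun γ => ?_
            map_one_left := fun γ => ?_ }⟩
  · exact Subtype.ext (ContinuousMap.ext fun x => congrArg γ.1 (H.map_zero_left x))
  · exact Subtype.ext (ContinuousMap.ext fun x => congrArg γ.1 (H.map_one_left x))

/-- Precomposition with a pointed homotopy equivalence is a homotopy equivalence. -/
theorem homotopyEquiv_precomp [LocallyCompactSpace X] [LocallyCompactSpace Y] {f : X ⟶ Y}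
    (hf : homotopyEquivalences f) (B : PointedTop.{v}) :
    TopCat.homotopyEquivalences ((mapsTo B).map f.op) := by
  obtain ⟨g, hfg, hgf⟩ := hf
  refine ⟨⟨((mapsTo B).map f.op).hom, ((mapsTo B).map g.op).hom, ?_, ?_⟩, rfl⟩
  -- Precomposition reverses the order, so the two homotopies exchange roles.
  · have h := homotopic_precomp hgf B
    exact h
  · have h := homotopic_precomp hfg B
    exact h

/-- The functor `Top_*(-, B)` is colax monoidal, by restriction to the summands of the wedge. -/
@[reducible]
def mapsToOplaxMonoidal (B : PointedTop.{v}) : (mapsTo.{u, v} B).OplaxMonoidal where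
  η := TopCat.ofHom ⟨fun _ => PUnit.unit, continuous_const⟩
  δ X Y := CartesianMonoidalCategory.lift
    ((mapsTo B).map (wedge.inl X.unop Y.unop).op) ((mapsTo B).map (wedge.inr X.unop Y.unop).op)
  δ_natural_left _ _ := rfl
  δ_natural_right _ _ := rfl
  oplax_associativity _ _ _ := rfl
  oplax_left_unitality _ := rfl
  oplax_right_unitality _ := rfl

/-- Restriction to the summands of a wedge is a homeomorphism. -/
def mapsToWedgeHomeomorph [T1Space X] [T1Space Y] [LocallyCompactSpace X]
    [LocallyCompactSpace Y] (B : PointedTop.{v}) :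
    Map (wedge X Y) B ≃ₜ Map X B × Map Y B where
  toFun γ := (Map.comp (wedge.inl X Y) γ, Map.comp (wedge.inr X Y) γ)
  invFun p := Map.wedgeDesc p.1 p.2
  left_inv γ := by
    refine Subtype.ext (ContinuousMap.ext ?_)
    rintro ⟨x | y⟩ <;> rfl
  right_inv _ := rfl
  continuous_toFun :=
    ((mapsTo B).map (wedge.inl X Y).op).hom.continuous.prodMk
      ((mapsTo B).map (wedge.inr X Y).op).hom.continuous
  continuous_invFun := Map.continuous_wedgeDesc B

end PointedTop

/-- The colax monoidal structure on `Top_*(W(-), B)`. -/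
@[reducible]
def loopFunctorOplaxMonoidal (B : PointedTop.{u}) : (loopFunctor B).OplaxMonoidal :=
  letI := collapsedSimplexOplaxMonoidal
  letI := PointedTop.mapsToOplaxMonoidal.{0, u} B
  inferInstanceAs (collapsedSimplexFunctor ⋙ PointedTop.mapsTo.{0, u} B).OplaxMonoidal

theorem isHomotopyMonoid_loopFunctor (B : PointedTop.{u}) :
    IsHomotopyMonoid TopCat.homotopyEquivalences (loopFunctor B)
      (loopFunctorOplaxMonoidal B) where
  unit_equivalence := by
    let e : PointedTop.Map PointedTop.point.{0} B ≃ₜ PUnit.{u + 1} :=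
      { toFun := fun _ => PUnit.unit
        invFun := fun _ => PointedTop.constPt _ B
        left_inv := fun γ => Subtype.ext (ContinuousMap.ext fun _ => γ.2.symm)
        right_inv := fun _ => rfl
        continuous_toFun := continuous_const
        continuous_invFun := continuous_const }
    have : LocallyCompactSpace PointedTop.point.{0} :=
      inferInstanceAs (LocallyCompactSpace PUnit)
    obtain ⟨h, hh⟩ := PointedTop.homotopyEquiv_precomp
      homotopyEquivalences_fromPoint_collapsedSimplex_zero B
    refine ⟨h.trans e.toHomotopyEquiv, ?_⟩
    rfl
  tensor_equivalence m n := by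
    obtain ⟨h, hh⟩ := PointedTop.homotopyEquiv_precomp
      (homotopyEquivalences_faceInclusion m n) B
    -- The structure map is precomposition with the face inclusion, followed by restriction to the
    -- two summands.
    refine ⟨h.trans (PointedTop.mapsToWedgeHomeomorph B).toHomotopyEquiv, ?_⟩
    change ContinuousMap.comp _ h.toFun = _
    rw [hh]
    rfl

/-! ### The circle -/

theorem continuous_simplexToCircle : Continuous simplexToCircle :=
  Circle.exp.continuous.comp (continuous_const.mul (continuous_coord 1))

theorem simplexToCircle_vertex (i : Fin 2) : simplexToCircle (vertex i) = 1 := by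
  fin_cases i
  · simp [simplexToCircle]
  · simp [simplexToCircle]

/-- The map `W(1) ⟶ S¹` given by `t ↦ exp(2πi t₁)`. -/
def collapsedToCircle : collapsedSimplex 1 ⟶ PointedTop.circle :=
  collapsedDesc simplexToCircle continuous_simplexToCircle simplexToCircle_vertex

theorem isVertex_of_apply_one {t : stdSimplex ℝ (Fin 2)} (h : t 1 = 0 ∨ t 1 = 1) :
    IsVertex t := by
  apply isVertex_of_vertexDefect_eq_zero
  have h0 := add_eq_one t
  rw [vertexDefect, Fin.sum_univ_two]
  rcases h with h | h
  · rw [show t 0 = 1 by linarith, h]; norm_num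
  · rw [show t 0 = 0 by linarith, h]; norm_num

theorem injective_collapsedToCircle : Function.Injective collapsedToCircle.1 := by
  rintro ⟨s⟩ ⟨t⟩ h
  apply Quotient.sound
  obtain ⟨k, hk⟩ := Circle.exp_eq_exp.1 (h : simplexToCircle s = simplexToCircle t)
  have hk' : s 1 = t 1 + k := by
    have hpi := Real.two_pi_pos.ne'
    apply mul_left_cancel₀ hpi
    rw [hk]
    ring
  have hs0 := zero_le s 1
  have hs1 := le_one s 1
  have ht0 := zero_le t 1
  have ht1 := le_one t 1
  have hk1 : k ≤ 1 := by exact_mod_cast (by linarith : (k : ℝ) ≤ 1)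
  have hk2 : -1 ≤ k := by exact_mod_cast (by linarith : (-1 : ℝ) ≤ k)
  -- Both parameters lie in the unit interval; a difference of `±1` puts them at opposite ends, so
  -- both points are vertices.
  obtain rfl | rfl | rfl : k = -1 ∨ k = 0 ∨ k = 1 := by omega
  · push_cast at hk'
    exact Or.inr ⟨isVertex_of_apply_one (Or.inl (by linarith)),
      isVertex_of_apply_one (Or.inr (by linarith))⟩
  · refine Or.inl (stdSimplex.ext (funext fun i => ?_))
    push_cast at hk'
    have h1 := add_eq_one s
    have h2 := add_eq_one t
    fin_cases i
    · change s 0 = t 0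
      linarith
    · change s 1 = t 1
      linarith
  · push_cast at hk'
    exact Or.inr ⟨isVertex_of_apply_one (Or.inr (by linarith)),
      isVertex_of_apply_one (Or.inl (by linarith))⟩

theorem surjective_collapsedToCircle : Function.Surjective collapsedToCircle.1 := by
  intro z
  obtain ⟨x, hx⟩ : ∃ x : ℝ, Circle.exp x = z := ⟨_, Circle.exp_arg z⟩
  have hy0 := Int.fract_nonneg (x / (2 * Real.pi))
  have hy1 := (Int.fract_lt_one (x / (2 * Real.pi))).le
  -- The coordinate `t 1` is the angle in full turns, reduced modulo one.
  let t : stdSimplex ℝ (Fin 2) :=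
    ⟨![1 - Int.fract (x / (2 * Real.pi)), Int.fract (x / (2 * Real.pi))], by
      constructor
      · intro i
        fin_cases i
        · exact sub_nonneg.2 hy1
        · exact hy0
      · simp⟩
  refine ⟨collapse 1 t, ?_⟩
  change Circle.exp (2 * Real.pi * Int.fract (x / (2 * Real.pi))) = z
  rw [← hx, Circle.exp_eq_exp]
  refine ⟨-⌊x / (2 * Real.pi)⌋, ?_⟩
  rw [Int.fract, mul_sub, mul_div_cancel₀ _ Real.two_pi_pos.ne']
  push_cast
  ring

/-- The homeomorphism between the collapsed interval and the circle. -/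
def collapsedHomeomorphCircle : collapsedSimplex 1 ≃ₜ Circle :=
  Continuous.homeoOfEquivCompactToT2
    (f := Equiv.ofBijective (fun x => (collapsedToCircle.1 x : Circle))
      ⟨injective_collapsedToCircle, surjective_collapsedToCircle⟩)
    collapsedToCircle.1.continuous

/-- The pointed homeomorphism between `W(1)` and `S¹`. -/
def collapsedIsoCircle : collapsedSimplex 1 ≅ PointedTop.circle where
  hom := collapsedToCircle
  inv := ⟨⟨collapsedHomeomorphCircle.symm, collapsedHomeomorphCircle.symm.continuous⟩,
    (Homeomorph.symm_apply_eq _).2 collapsedToCircle.2.symm⟩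
  hom_inv_id := PointedTop.hom_ext fun x => collapsedHomeomorphCircle.symm_apply_apply x
  inv_hom_id := PointedTop.hom_ext fun x => collapsedHomeomorphCircle.apply_symm_apply x

end

theorem proposition4p1 :
    -- `S¹` is a homotopy comonoid: `W(1) = S¹`, and the face inclusions make `W` a homotopy monoid
    -- in `(Top_*ᵒᵖ, ∨)`
    ∃ c : collapsedSimplex 1 ≅ PointedTop.circle,
      (∀ t : stdSimplex ℝ (Fin 2), c.hom.1 (collapse 1 t) = simplexToCircle t) ∧
      (∃ ω : collapsedSimplexFunctor.OplaxMonoidal,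
        IsHomotopyMonoid PointedTop.homotopyEquivalences.op collapsedSimplexFunctor ω ∧
        ∀ m n : AugmentedSimplexCategory, ω.δ m n = (faceInclusion m n).op) ∧
      -- the loop space of every pointed space is a homotopy monoid in `(Top, ×)`
      ∃ ξ : ∀ B : PointedTop.{u}, (loopFunctor B).OplaxMonoidal,
        (∀ B : PointedTop.{u},
          IsHomotopyMonoid TopCat.homotopyEquivalences (loopFunctor B) (ξ B) ∧
          (∃ e : (loopFunctor B).obj oneOrdinal ≅ PointedTop.loopSpace B,
            e.inv = (PointedTop.mapsTo.{0, u} B).map c.hom.op) ∧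
          ∀ m n : AugmentedSimplexCategory,
            (ξ B).δ m n ≫ CartesianMonoidalCategory.fst _ _ =
              (PointedTop.mapsTo.{0, u} B).map (frontFace m n).op ∧
            (ξ B).δ m n ≫ CartesianMonoidalCategory.snd _ _ =
              (PointedTop.mapsTo.{0, u} B).map (backFace m n).op) ∧
        -- and this structure is natural in the pointed space
        ∀ {B B' : PointedTop.{u}} (g : B ⟶ B') (m n : AugmentedSimplexCategory),
          (loopFunctorMap g).app (m ⊗ n) ≫ (ξ B').δ m n =
            (ξ B).δ m n ≫ ((loopFunctorMap g).app m ⊗ₘ (loopFunctorMap g).app n) := by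

  refine ⟨collapsedIsoCircle, fun _ => rfl,
    ⟨collapsedSimplexOplaxMonoidal, isHomotopyMonoid_collapsedSimplexFunctor, fun _ _ => rfl⟩,
    loopFunctorOplaxMonoidal, fun B => ⟨isHomotopyMonoid_loopFunctor B, ?_, fun _ _ => ?_⟩, ?_⟩
  -- Precomposition with `c` goes from loops to `X(1)`, so it is the inverse of the required
  -- isomorphism.
  · exact ⟨((PointedTop.mapsTo.{0, u} B).mapIso collapsedIsoCircle.op).symm, rfl⟩
  · exact ⟨rfl, rfl⟩
  · intro B B' g m n
    -- Restriction is precomposition, which commutes with postcomposition by `g`.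
    rfl
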